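/- **Theorem.** Let $k\ge 1$ and let $A$ be a real $k\times k$ matrix all of whose (complex) eigenvalues are real and lie in $[-1,1]$. Let $m\ge 1$ be the size of the largest Jordan block in the Jordan form of $A$. Let $f:[-1,1]\to\mathbb{R}$ satisfy $f\in C^{2m-2}([-1,1])$ (with one-sided derivatives at the endpoints), and suppose that $f^{(2m-2)}$ is absolutely continuous on $[-1,1]$ and that $f^{(2m-1)}$ is of bounded variation, meaning that $f^{(2m-1)}$, which exists almost everywhere, agrees almost everywhere on $[-1,1]$ with a function of finite total variation. Let $T_n$ denote the Chebyshev polynomial of the first kind of degree $n$, and put $$\alpha_n[f]=\frac{2}{\pi}\int_{-1}^{1}\frac{f(t)\,T_n(t)}{\sqrt{1-t^2}}\,dt,\qquad n=0,1,2,\ldots$$ Then the matrix Chebyshev expansion $$\mathcal S_\infty(f)(A)=\tfrac12\,\alpha_0[f]\,T_0(A)+\sum_{n=1}^{\infty}\alpha_n[f]\,T_n(A)$$ is absolutely convergent: for every norm $\|\cdot\|$ on the space of real $k\times k$ matrices, $$\tfrac12\,\|\alpha_0[f]\,T_0(A)\|+\sum_{n=1}^{\infty}\|\alpha_n[f]\,T_n(A)\|<\infty,$$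 and in particular the partial sums $\tfrac12\alpha_0[f]T_0(A)+\sum_{n=1}^{N}\alpha_n[f]T_n(A)$ converge as $N\to\infty$. -/

import Mathlib

open Set Filter Topology MeasureTheory

/-- The upper triangular `s × s` Jordan block with eigenvalue `μ`: `μ` on the diagonal and
`1` on the first superdiagonal. -/
def jordanBlock (s : ℕ) (μ : ℝ) : Matrix (Fin s) (Fin s) ℝ :=
  Matrix.of fun i j => if i = j then μ else if (i : ℕ) + 1 = (j : ℕ) then 1 else 0

/-- A (real) Jordan form of `A`: an invertible `Z` with `A = Z⁻¹ J Z`, where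
`J = diag(J₁, …, J_p)` is block diagonal and `J_i` is the Jordan block of order `size i ≥ 1` with
eigenvalue `eigenvalue i`. The bijection `index` numbers the rows of `J` by `Fin k`. -/
structure JordanForm {k : ℕ} (A : Matrix (Fin k) (Fin k) ℝ) where
  numBlocks : ℕ
  size : Fin numBlocks → ℕ
  size_pos : ∀ i, 1 ≤ size i
  eigenvalue : Fin numBlocks → ℝ
  index : (Σ i, Fin (size i)) ≃ Fin k
  Z : Matrix (Fin k) (Fin k) ℝ
  isUnit_Z : IsUnit Z
  eq_conj : A = Z⁻¹ * Matrix.reindex index index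
    (Matrix.blockDiagonal' fun i => jordanBlock (size i) (eigenvalue i)) * Z

/-- The size of the largest Jordan block in the Jordan form of `A`. (The Jordan form is unique up
to the order of its blocks, so all Jordan forms of `A` have the same block sizes; these are at
most `k`, so the supremum is a maximum.) -/
noncomputable def largestJordanBlockSize {k : ℕ} (A : Matrix (Fin k) (Fin k) ℝ) : ℕ :=
  sSup {s : ℕ | ∃ (J : JordanForm A) (i : Fin J.numBlocks), J.size i = s}

/-- The derivative of `F` on `[a, b]`, which need only exist almost everywhere, is of bounded
variation: it agrees almost everywhere with a function of finite total variation. For absolutely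
continuous `F` this says that the distributional derivative of `F'` is a finite measure. -/
def HasDerivOfBoundedVariation (F : ℝ → ℝ) (a b : ℝ) : Prop :=
  ∃ g : ℝ → ℝ, BoundedVariationOn g (Icc a b) ∧
    ∀ᵐ x ∂(volume.restrict (Icc a b)), HasDerivWithinAt F (g x) (Icc a b) x

/-- The Chebyshev coefficient `α_n[f] = (2/π) ∫_{-1}^{1} f(t) T_n(t) / √(1 - t²) dt`. -/
noncomputable def chebyshevCoeff (f : ℝ → ℝ) (n : ℕ) : ℝ :=
  (2 / Real.pi) *
    ∫ t in (-1 : ℝ)..1, f t * (Polynomial.Chebyshev.T ℝ (n : ℤ)).eval t / Real.sqrt (1 - t ^ 2)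

/-- The `n`-th term of the matrix Chebyshev expansion: `α_n[f] T_n(A)`, halved for `n = 0`. -/
noncomputable def matrixChebyshevTerm {k : ℕ} (f : ℝ → ℝ) (A : Matrix (Fin k) (Fin k) ℝ)
    (n : ℕ) : Matrix (Fin k) (Fin k) ℝ :=
  ((if n = 0 then 1 / 2 else 1) * chebyshevCoeff f n) •
    Polynomial.aeval A (Polynomial.Chebyshev.T ℝ (n : ℤ))

/-- The partial sum `S_N(f)(A)` of the matrix Chebyshev expansion (terms `0, …, N`). -/
noncomputable def matrixChebyshevPartialSum {k : ℕ} (f : ℝ → ℝ) (A : Matrix (Fin k) (Fin k) ℝ)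
    (N : ℕ) : Matrix (Fin k) (Fin k) ℝ :=
  ∑ n ∈ Finset.range (N + 1), matrixChebyshevTerm f A n

/-! The decay of the scalar coefficients beats the growth of `T_n(A)` by a factor `n ^ (-2)`.

Growth: in a Jordan basis, Taylor expansion at each eigenvalue μ_i, cut off by nilpotency, writes
`T_n(A)` as a sum over blocks i and r < size i of `T_n^(r)(μ_i) / r!` times a matrix independent of
n (`JordanForm.aeval_eq_sum`). Since |μ_i| ≤ 1, a Markov-type bound gives `|T_n^(r)(μ_i)| ≤ n ^ (2 *
r)`, and r ≤ m - 1.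

Decay: with t = cos θ the coefficients are Fourier cosine coefficients, hence O(1/n) for bounded
variation. Each integration by parts gains a factor 1/n, and 2m - 1 of them give O(n ^ (-2m))
(`exists_abs_chebyshevCoeff_le`).

A real Jordan form exists by the structure theorem for torsion modules over `ℝ[X]`. -/

/-! ### Derivatives of Chebyshev polynomials -/

open Polynomial.Chebyshev in
theorem iterate_derivative_T_eval_one_le (n k : ℕ) :
    (Polynomial.derivative^[k] (T ℝ (n : ℤ))).eval 1 ≤ (n : ℝ) ^ (2 * k) := by
  induction k with
  | zero => simp
  | succ k ih =>
    have hrec := iterate_derivative_T_eval_one_recurrence (R := ℝ) n k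
    -- The value at 1 dominates the absolute value on [-1, 1], so it is nonnegative; the factor 2k +
    -- 1 and the term -k² in the recurrence can then be dropped.
    have h0 : ∀ j, 0 ≤ (Polynomial.derivative^[j] (T ℝ (n : ℤ))).eval 1 := fun j =>
      (abs_nonneg _).trans (abs_iterate_derivative_T_real_le n j (x := 1) (by simp))
    have h1 := h0 (k + 1)
    have h2 := h0 k
    calc (Polynomial.derivative^[k + 1] (T ℝ (n : ℤ))).eval 1
        ≤ (2 * k + 1) * (Polynomial.derivative^[k + 1] (T ℝ (n : ℤ))).eval 1 := by
          nlinarith [mul_nonneg (Nat.cast_nonneg (α := ℝ) k) h1]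
      _ = ((n : ℝ) ^ 2 - k ^ 2) * (Polynomial.derivative^[k] (T ℝ (n : ℤ))).eval 1 := by
          simpa using hrec
      _ ≤ (n : ℝ) ^ 2 * (n : ℝ) ^ (2 * k) := by
          have : 0 ≤ (k : ℝ) ^ 2 * (Polynomial.derivative^[k] (T ℝ (n : ℤ))).eval 1 := by
            positivity
          nlinarith [mul_le_mul_of_nonneg_left ih (sq_nonneg (n : ℝ))]
      _ = _ := by ring

/-- A crude form of the Markov brothers' inequality for Chebyshev polynomials. -/
theorem abs_iterate_derivative_T_le (n k : ℕ) {x : ℝ} (hx : |x| ≤ 1) :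
    |(Polynomial.derivative^[k] (Polynomial.Chebyshev.T ℝ (n : ℤ))).eval x| ≤
      (n : ℝ) ^ (2 * k) :=
  (Polynomial.Chebyshev.abs_iterate_derivative_T_real_le n k hx).trans
    (iterate_derivative_T_eval_one_le n k)

/-! ### Chebyshev coefficients of functions of bounded variation -/

theorem chebyshevCoeff_eq_integral_cos (f : ℝ → ℝ) (n : ℕ) :
    chebyshevCoeff f n =
      (2 / Real.pi) * ∫ θ in (0 : ℝ)..Real.pi, f (Real.cos θ) * Real.cos (n * θ) := by
  have h := Polynomial.Chebyshev.integral_measureT_eq_integral_cos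
    (f := fun t => f t * (Polynomial.Chebyshev.T ℝ (n : ℤ)).eval t)
  rw [Polynomial.Chebyshev.integral_measureT] at h
  simp only [Polynomial.Chebyshev.T_real_cos, Int.cast_natCast] at h
  rw [chebyshevCoeff, ← h]
  simp [div_eq_mul_inv]

theorem BoundedVariationOn.aestronglyMeasurable {g : ℝ → ℝ} {a b : ℝ}
    (hg : BoundedVariationOn g (Icc a b)) :
    AEStronglyMeasurable g (volume.restrict (Icc a b)) := by
  obtain ⟨p, q, hp, hq, rfl⟩ :=
    hg.locallyBoundedVariationOn.exists_monotoneOn_sub_monotoneOn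
  exact ((aemeasurable_restrict_of_monotoneOn measurableSet_Icc hp).sub
    (aemeasurable_restrict_of_monotoneOn measurableSet_Icc hq)).aestronglyMeasurable

theorem BoundedVariationOn.exists_abs_le {g : ℝ → ℝ} {a b : ℝ}
    (hg : BoundedVariationOn g (Icc a b)) : ∃ C, ∀ x ∈ Icc a b, |g x| ≤ C := by
  refine ⟨(eVariationOn g (Icc a b)).toReal + |g a|, fun x hx => ?_⟩
  have ha : a ∈ Icc a b := ⟨le_rfl, hx.1.trans hx.2⟩
  have h := hg.dist_le hx ha
  rw [Real.dist_eq] at h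
  linarith [abs_sub_abs_le_abs_sub (g x) (g a)]

theorem BoundedVariationOn.intervalIntegrable_mul {g w : ℝ → ℝ} {a b : ℝ} (hab : a ≤ b)
    (hg : BoundedVariationOn g (Icc a b)) (hw : IntervalIntegrable w volume a b) :
    IntervalIntegrable (fun x => g x * w x) volume a b := by
  obtain ⟨C, hC⟩ := hg.exists_abs_le
  rw [intervalIntegrable_iff_integrableOn_Icc_of_le hab] at hw ⊢
  exact Integrable.bdd_mul hw hg.aestronglyMeasurable
    ((ae_restrict_iff' measurableSet_Icc).2 (ae_of_all _ hC))

theorem intervalIntegral_cos_nat_mul_eq_zero {n : ℕ} (hn : n ≠ 0) (j : ℕ) :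
    ∫ θ in (j * Real.pi / n)..((j + 1 : ℕ) * Real.pi / n), Real.cos (n * θ) = 0 := by
  have hn' : (n : ℝ) ≠ 0 := Nat.cast_ne_zero.2 hn
  rw [intervalIntegral.integral_comp_mul_left _ hn', integral_cos, mul_div_cancel₀ _ hn',
    mul_div_cancel₀ _ hn', Real.sin_nat_mul_pi, Real.sin_nat_mul_pi]
  simp

/-- The Fourier cosine coefficients of a function of bounded variation are `O(1 / n)`. -/
theorem BoundedVariationOn.abs_integral_mul_cos_le {h : ℝ → ℝ}
    (hh : BoundedVariationOn h (Icc 0 Real.pi)) {n : ℕ} (hn : n ≠ 0) :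
    |∫ θ in (0 : ℝ)..Real.pi, h θ * Real.cos (n * θ)| ≤
      Real.pi / n * (eVariationOn h (Icc 0 Real.pi)).toReal := by
  have hn' : (n : ℝ) ≠ 0 := Nat.cast_ne_zero.2 hn
  have hn0 : (0 : ℝ) < n := by positivity
  -- Cut [0, π] into n half-periods. The cosine has mean zero on each, so h may be replaced there by
  -- h - h(t j), which is at most the local variation; these variations add up to the total one.
  set t : ℕ → ℝ := fun j => j * Real.pi / n with ht
  have ht0 : t 0 = 0 := by simp [ht]
  have htn : t n = Real.pi := by simp [ht]; field_simp
  have htm : Monotone t := fun i j hij => by simp only [ht]; gcongr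
  have hsub : ∀ j < n, Icc (t j) (t (j + 1)) ⊆ Icc 0 Real.pi := fun j hj => by
    rw [← ht0, ← htn]
    exact Icc_subset_Icc (htm (Nat.zero_le _)) (htm hj)
  have hint : ∀ j < n, IntervalIntegrable (fun θ => h θ * Real.cos (n * θ)) volume (t j)
      (t (j + 1)) := fun j hj =>
    (hh.mono (hsub j hj)).intervalIntegrable_mul (htm (Nat.le_succ j))
      ((by fun_prop : Continuous fun θ : ℝ => Real.cos (n * θ)).intervalIntegrable _ _)
  have hpiece : ∀ j < n, |∫ θ in (t j)..(t (j + 1)), h θ * Real.cos (n * θ)| ≤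
      Real.pi / n * (eVariationOn h (Icc (t j) (t (j + 1)))).toReal := by
    intro j hj
    have hle := htm (Nat.le_succ j)
    have hbv := hh.mono (hsub j hj)
    have e1 : ∫ θ in (t j)..(t (j + 1)), h θ * Real.cos (n * θ) =
        ∫ θ in (t j)..(t (j + 1)), (h θ - h (t j)) * Real.cos (n * θ) := by
      simp_rw [sub_mul]
      rw [intervalIntegral.integral_sub (hint j hj)
        ((by fun_prop : Continuous fun θ : ℝ => h (t j) * Real.cos (n * θ)).intervalIntegrable
          _ _), intervalIntegral.integral_const_mul, intervalIntegral_cos_nat_mul_eq_zero hn j]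
      simp
    rw [e1]
    have := intervalIntegral.norm_integral_le_of_norm_le_const (a := t j) (b := t (j + 1))
      (f := fun θ => (h θ - h (t j)) * Real.cos (n * θ))
      (C := (eVariationOn h (Icc (t j) (t (j + 1)))).toReal) (fun θ hθ => by
        rw [uIoc_of_le hle] at hθ
        rw [norm_mul]
        have h1 := hbv.dist_le (Ioc_subset_Icc_self hθ) (left_mem_Icc.2 hle)
        rw [dist_eq_norm] at h1
        calc _ ≤ _ * 1 := mul_le_mul h1 (Real.abs_cos_le_one _) (abs_nonneg _)
              ENNReal.toReal_nonneg
          _ = _ := mul_one _)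
    have hlen : |t (j + 1) - t j| = Real.pi / n := by
      rw [abs_of_nonneg (sub_nonneg.2 hle)]
      simp only [ht]; push_cast; ring
    rw [hlen, mul_comm, Real.norm_eq_abs] at this
    exact this
  have hsum := intervalIntegral.sum_integral_adjacent_intervals hint
  rw [ht0, htn] at hsum
  rw [← hsum]
  refine (Finset.abs_sum_le_sum_abs _ _).trans
    ((Finset.sum_le_sum fun j hj => hpiece j (Finset.mem_range.1 hj)).trans_eq ?_)
  rw [← Finset.mul_sum, ← ENNReal.toReal_sum fun j hj => hh.mono (hsub j (Finset.mem_range.1 hj)),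
    eVariationOn.sum' h htm, ht0, htn]

/-- The Chebyshev coefficients of a function of bounded variation are `O(1 / n)`. -/
theorem BoundedVariationOn.exists_abs_chebyshevCoeff_le {g : ℝ → ℝ}
    (hg : BoundedVariationOn g (Icc (-1) 1)) :
    ∃ C, ∀ n : ℕ, |chebyshevCoeff g n| ≤ C / (n + 1) := by
  set h : ℝ → ℝ := g ∘ Real.cos with hdef
  have hh : BoundedVariationOn h (Icc 0 Real.pi) :=
    ne_top_of_le_ne_top hg (eVariationOn.comp_le_of_antitoneOn g Real.cos
      Real.strictAntiOn_cos.antitoneOn (fun θ _ => Real.cos_mem_Icc θ))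
  set V := (eVariationOn h (Icc 0 Real.pi)).toReal
  have hV : 0 ≤ V := ENNReal.toReal_nonneg
  -- The variation does not control the coefficient at n = 0, hence the maximum; 4 V comes from 2 V
  -- / n and n + 1 ≤ 2 n.
  refine ⟨max |chebyshevCoeff g 0| (4 * V), fun n => ?_⟩
  rcases eq_or_ne n 0 with rfl | hn
  · simp
  have hn1 : (1 : ℝ) ≤ n := by exact_mod_cast Nat.one_le_iff_ne_zero.2 hn
  have key := hh.abs_integral_mul_cos_le hn
  have hpi := Real.pi_pos
  rw [chebyshevCoeff_eq_integral_cos, abs_mul, abs_of_pos (by positivity : 0 < 2 / Real.pi)]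
  calc _ ≤ 2 / Real.pi * (Real.pi / n * V) := by gcongr; exact key
    _ = 2 * V / n := by field_simp
    _ ≤ 4 * V / (n + 1) := by
        rw [div_le_div_iff₀ (by positivity) (by positivity)]
        nlinarith
    _ ≤ _ := by gcongr; exact le_max_right _ _

/-! ### Integration by parts and decay of the coefficients -/

-- With x = cos θ this is 2 sin(nθ) sin θ = cos((n-1)θ) - cos((n+1)θ). It turns the integral left
-- after integration by parts into two Chebyshev coefficients.
open Polynomial.Chebyshev in
theorem sin_mul_arccos_eq {n : ℕ} (hn : n ≠ 0) {x : ℝ} (hx : x ∈ Ioo (-1 : ℝ) 1) :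
    Real.sin (n * Real.arccos x) =
      ((T ℝ ((n - 1 : ℕ) : ℤ)).eval x - (T ℝ ((n + 1 : ℕ) : ℤ)).eval x) / 2 *
        (Real.sqrt (1 - x ^ 2))⁻¹ := by
  have hs : 0 < Real.sqrt (1 - x ^ 2) := Real.sqrt_pos.2 (by nlinarith [hx.1, hx.2])
  have hc := Real.cos_arccos hx.1.le hx.2.le
  have hT : ∀ k : ℕ, (T ℝ (k : ℤ)).eval x = Real.cos (k * Real.arccos x) := fun k => by
    conv_lhs => rw [← hc]
    rw [T_real_cos]; simp
  rw [hT, hT, Nat.cast_sub (Nat.one_le_iff_ne_zero.2 hn)]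
  push_cast
  rw [sub_mul, add_mul, one_mul, Real.cos_sub, Real.cos_add, Real.sin_arccos]
  field_simp
  ring

theorem intervalIntegrable_eval_T_div_sqrt (n : ℕ) :
    IntervalIntegrable (fun x => (Polynomial.Chebyshev.T ℝ (n : ℤ)).eval x *
      (Real.sqrt (1 - x ^ 2))⁻¹) volume (-1) 1 := by
  have := Polynomial.Chebyshev.intervalIntegrable_sqrt_one_sub_sq_inv.continuousOn_mul
    (g := fun x => (Polynomial.Chebyshev.T ℝ (n : ℤ)).eval x) (by fun_prop)
  simpa using this

theorem hasDerivAt_sin_mul_arccos (n : ℕ) {x : ℝ} (hx : x ∈ Ioo (-1 : ℝ) 1) :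
    HasDerivAt (fun x => Real.sin (n * Real.arccos x))
      (-n * ((Polynomial.Chebyshev.T ℝ (n : ℤ)).eval x * (Real.sqrt (1 - x ^ 2))⁻¹)) x := by
  have h := (((Real.hasDerivAt_arccos hx.1.ne' hx.2.ne).const_mul (n : ℝ))).sin
  convert! h using 1
  have hc := Real.cos_arccos hx.1.le hx.2.le
  have hT : (Polynomial.Chebyshev.T ℝ (n : ℤ)).eval x = Real.cos (n * Real.arccos x) := by
    conv_lhs => rw [← hc]
    rw [Polynomial.Chebyshev.T_real_cos]; simp
  rw [hT]
  ring

/-- By the fundamental theorem of calculus w is a constant plus the integral of w'. Only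
integrability of w' is needed, so the endpoint singularities of 1 / √(1 - x²) are allowed. -/
theorem absolutelyContinuousOnInterval_of_hasDerivAt {w w' : ℝ → ℝ} {a b : ℝ} (hab : a ≤ b)
    (hc : ContinuousOn w (Icc a b)) (hd : ∀ x ∈ Ioo a b, HasDerivAt w (w' x) x)
    (hi : IntervalIntegrable w' volume a b) : AbsolutelyContinuousOnInterval w a b := by
  have h1 := hi.absolutelyContinuousOnInterval_intervalIntegral (c := a) left_mem_uIcc
  have h2 : AbsolutelyContinuousOnInterval (fun _ : ℝ => w a) a b :=
    ((LipschitzWith.const (w a)).lipschitzOnWith).absolutelyContinuousOnInterval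
  have h3 := h2.add h1
  have heq : ∀ x ∈ uIcc a b, w x = w a + ∫ v in a..x, w' v := by
    intro x hx
    rw [uIcc_of_le hab] at hx
    rw [intervalIntegral.integral_eq_sub_of_hasDerivAt_of_le hx.1
      (hc.mono (Icc_subset_Icc_right hx.2)) (fun y hy => hd y ⟨hy.1, hy.2.trans_le hx.2⟩)
      (hi.mono_set (by rw [uIcc_of_le hab, uIcc_of_le hx.1]; exact Icc_subset_Icc_right hx.2))]
    ring
  rw [absolutelyContinuousOnInterval_iff] at h3 ⊢
  intro ε hε
  obtain ⟨δ, hδ, H⟩ := h3 ε hε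
  refine ⟨δ, hδ, fun E hE hE' => ?_⟩
  convert! H E hE hE' using 1
  refine Finset.sum_congr rfl fun i hi => ?_
  have hm := hE.1 i hi
  rw [heq _ hm.1, heq _ hm.2]
  rfl

theorem absolutelyContinuousOnInterval_sin_mul_arccos (n : ℕ) :
    AbsolutelyContinuousOnInterval (fun x => Real.sin (n * Real.arccos x)) (-1) 1 :=
  absolutelyContinuousOnInterval_of_hasDerivAt (by norm_num)
    (by fun_prop) (fun _ hx => hasDerivAt_sin_mul_arccos n hx)
    ((intervalIntegrable_eval_T_div_sqrt n).const_mul _)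

/-- Integration by parts for Chebyshev coefficients. -/
theorem AbsolutelyContinuousOnInterval.chebyshevCoeff_eq {F g : ℝ → ℝ}
    (hF : AbsolutelyContinuousOnInterval F (-1) 1) (hg : BoundedVariationOn g (Icc (-1) 1))
    (hFg : ∀ᵐ x ∂(volume.restrict (Icc (-1 : ℝ) 1)), HasDerivWithinAt F (g x) (Icc (-1) 1) x)
    {n : ℕ} (hn : n ≠ 0) :
    chebyshevCoeff F n = (chebyshevCoeff g (n - 1) - chebyshevCoeff g (n + 1)) / (2 * n) := by
  have hn' : (n : ℝ) ≠ 0 := Nat.cast_ne_zero.2 hn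
  have hIoo : ∀ᵐ x : ℝ, x ∈ uIoc (-1 : ℝ) 1 → x ∈ Ioo (-1 : ℝ) 1 := by
    have : ∀ᵐ x : ℝ, x ≠ 1 := by simp [ae_iff]
    filter_upwards [this] with x hx hx'
    rw [uIoc_of_le (by norm_num)] at hx'
    exact ⟨hx'.1, lt_of_le_of_ne hx'.2 hx⟩
  have hderiv : ∀ᵐ x : ℝ, x ∈ uIoc (-1 : ℝ) 1 → deriv F x = g x := by
    filter_upwards [(ae_restrict_iff' measurableSet_Icc).1 hFg, hIoo] with x h1 h2 hx
    exact ((h1 (Ioo_subset_Icc_self (h2 hx))).hasDerivAt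
      (Icc_mem_nhds (h2 hx).1 (h2 hx).2)).deriv
  have parts := hF.integral_mul_deriv_eq_deriv_mul
    (absolutelyContinuousOnInterval_sin_mul_arccos n)
  have e1 : ∫ x in (-1 : ℝ)..1, F x * deriv (fun x => Real.sin (n * Real.arccos x)) x =
      -n * ∫ x in (-1 : ℝ)..1,
        F x * (Polynomial.Chebyshev.T ℝ (n : ℤ)).eval x / Real.sqrt (1 - x ^ 2) := by
    rw [← intervalIntegral.integral_const_mul]
    refine intervalIntegral.integral_congr_ae ?_
    filter_upwards [hIoo] with x h2 hx
    rw [(hasDerivAt_sin_mul_arccos n (h2 hx)).deriv]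
    ring
  have hint : ∀ k : ℕ, IntervalIntegrable (fun x =>
      g x * (Polynomial.Chebyshev.T ℝ (k : ℤ)).eval x / Real.sqrt (1 - x ^ 2))
      volume (-1) 1 := fun k => by
    simpa only [div_eq_mul_inv, mul_assoc] using
      hg.intervalIntegrable_mul (by norm_num) (intervalIntegrable_eval_T_div_sqrt k)
  have e2 : ∫ x in (-1 : ℝ)..1, deriv F x * Real.sin (n * Real.arccos x) =
      ((∫ x in (-1 : ℝ)..1, g x * (Polynomial.Chebyshev.T ℝ ((n - 1 : ℕ) : ℤ)).eval x /
          Real.sqrt (1 - x ^ 2)) -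
        ∫ x in (-1 : ℝ)..1, g x * (Polynomial.Chebyshev.T ℝ ((n + 1 : ℕ) : ℤ)).eval x /
          Real.sqrt (1 - x ^ 2)) / 2 := by
    rw [← intervalIntegral.integral_sub (hint _) (hint _), ← intervalIntegral.integral_div]
    refine intervalIntegral.integral_congr_ae ?_
    filter_upwards [hIoo, hderiv] with x h2 h3 hx
    rw [h3 hx, sin_mul_arccos_eq hn (h2 hx)]
    ring
  rw [e1, e2] at parts
  -- The boundary terms vanish: sin(n arccos x) is zero at x = 1 and x = -1.
  simp only [Real.arccos_one, Real.arccos_neg_one, mul_zero, Real.sin_zero,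
    Real.sin_nat_mul_pi] at parts
  unfold chebyshevCoeff
  field_simp
  linarith

theorem exists_abs_chebyshevCoeff_le_of_deriv {F g : ℝ → ℝ}
    (hF : AbsolutelyContinuousOnInterval F (-1) 1) (hg : BoundedVariationOn g (Icc (-1) 1))
    (hFg : ∀ᵐ x ∂(volume.restrict (Icc (-1 : ℝ) 1)), HasDerivWithinAt F (g x) (Icc (-1) 1) x)
    {q : ℕ} (hq : ∃ C, ∀ n : ℕ, |chebyshevCoeff g n| ≤ C / (n + 1) ^ q) :
    ∃ C, ∀ n : ℕ, |chebyshevCoeff F n| ≤ C / (n + 1) ^ (q + 1) := by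
  obtain ⟨C, hC⟩ := hq
  have hC0 : 0 ≤ C := by simpa using (abs_nonneg _).trans (hC 0)
  -- The shift to n - 1 costs 2 ^ q, because n + 1 ≤ 2 n; the shift to n + 1 costs nothing.
  refine ⟨max |chebyshevCoeff F 0| (2 ^ q * C + C), fun n => ?_⟩
  rcases eq_or_ne n 0 with rfl | hn
  · simp
  have hn1 : (1 : ℝ) ≤ n := by exact_mod_cast Nat.one_le_iff_ne_zero.2 hn
  have h1 : |chebyshevCoeff g (n - 1)| ≤ 2 ^ q * C / (n + 1) ^ q := by
    refine (hC (n - 1)).trans ?_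
    rw [Nat.cast_sub (Nat.one_le_iff_ne_zero.2 hn), Nat.cast_one, sub_add_cancel,
      div_le_div_iff₀ (by positivity) (by positivity), mul_comm (2 ^ q) C, mul_assoc, ← mul_pow]
    gcongr
    linarith
  have h2 : |chebyshevCoeff g (n + 1)| ≤ C / (n + 1) ^ q := by
    refine (hC (n + 1)).trans ?_
    gcongr
    simp
  rw [hF.chebyshevCoeff_eq hg hFg hn, abs_div, abs_of_pos (by positivity : (0 : ℝ) < 2 * n)]
  calc _ ≤ (2 ^ q * C / (n + 1) ^ q + C / (n + 1) ^ q) / (n + 1) := by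
        gcongr
        · exact (abs_sub _ _).trans (add_le_add h1 h2)
        · linarith
    _ = (2 ^ q * C + C) / (n + 1) ^ (q + 1) := by field_simp; ring
    _ ≤ _ := by gcongr; exact le_max_right _ _

theorem absolutelyContinuousOnInterval_of_iteratedDerivWithin {p : ℕ} {f : ℝ → ℝ}
    (hf : ContDiffOn ℝ (p : WithTop ℕ∞) f (Icc (-1) 1))
    (hac : AbsolutelyContinuousOnInterval (iteratedDerivWithin p f (Icc (-1) 1)) (-1) 1) :
    AbsolutelyContinuousOnInterval f (-1) 1 := by
  rcases p with _ | p
  · simpa using hac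
  · refine ContDiffOn.absolutelyContinuousOnInterval ?_
    rw [uIcc_of_le (by norm_num)]
    exact hf.of_le (by exact_mod_cast Nat.le_add_left 1 p)

/-- Decay of the Chebyshev coefficients of a function whose `p`-th derivative is absolutely
continuous with a derivative of bounded variation. -/
theorem exists_abs_chebyshevCoeff_le {p : ℕ} {f : ℝ → ℝ}
    (hf : ContDiffOn ℝ (p : WithTop ℕ∞) f (Icc (-1) 1))
    (hac : AbsolutelyContinuousOnInterval (iteratedDerivWithin p f (Icc (-1) 1)) (-1) 1)
    (hbv : HasDerivOfBoundedVariation (iteratedDerivWithin p f (Icc (-1) 1)) (-1) 1) :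
    ∃ C, ∀ n : ℕ, |chebyshevCoeff f n| ≤ C / (n + 1) ^ (p + 2) := by
  have hAC := absolutelyContinuousOnInterval_of_iteratedDerivWithin hf hac
  induction p generalizing f with
  | zero =>
    obtain ⟨g, hg, hfg⟩ := hbv
    rw [iteratedDerivWithin_zero] at hfg
    refine exists_abs_chebyshevCoeff_le_of_deriv hAC hg hfg ?_
    simpa using hg.exists_abs_chebyshevCoeff_le
  | succ p ih =>
    have hu : UniqueDiffOn ℝ (Icc (-1 : ℝ) 1) := uniqueDiffOn_Icc (by norm_num)
    rw [iteratedDerivWithin_succ'] at hac hbv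
    have hf' : ContDiffOn ℝ (p : WithTop ℕ∞) (derivWithin f (Icc (-1) 1)) (Icc (-1) 1) :=
      hf.derivWithin hu (by exact_mod_cast le_rfl)
    have hAC' := absolutelyContinuousOnInterval_of_iteratedDerivWithin hf' hac
    -- Absolute continuity of f' makes it of bounded variation, as integration by parts for f
    -- requires.
    have hbv' := hAC'.boundedVariationOn
    rw [uIcc_of_le (by norm_num)] at hbv'
    refine exists_abs_chebyshevCoeff_le_of_deriv hAC hbv' ?_ (ih hf' hac hbv hAC')
    refine (ae_restrict_iff' measurableSet_Icc).2 (ae_of_all _ fun x hx => ?_)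
    exact (hf.differentiableOn (by simp) x hx).hasDerivWithinAt

/-! ### Existence of a real Jordan form -/

-- The basis consists of the powers (X - μ) ^ (e - 1 - j). In this decreasing order, X = μ + (X - μ)
-- sends the j-th vector to μ times itself plus the preceding one, which is zero when j = 0.
open Polynomial in
theorem exists_basis_quotient_X_sub_C_pow (μ : ℝ) (e : ℕ) (I : Ideal ℝ[X])
    (hI : I = Ideal.span {(X - C μ) ^ e}) :
    ∃ b : Module.Basis (Fin e) ℝ (ℝ[X] ⧸ I),
      ∀ j, (X : ℝ[X]) • b j = ∑ i, jordanBlock e μ i j • b i := by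
  set v : Fin e → ℝ[X] ⧸ I := fun j => Ideal.Quotient.mk I ((X - C μ) ^ (e - 1 - (j : ℕ)))
    with hv
  have hzero : ∀ n, e ≤ n → Ideal.Quotient.mk I ((X - C μ) ^ n) = 0 := fun n hn => by
    rw [Ideal.Quotient.eq_zero_iff_mem, hI]
    exact Ideal.mem_span_singleton.2 (pow_dvd_pow _ hn)
  have hspan : ⊤ ≤ Submodule.span ℝ (Set.range v) := by
    rintro x -
    obtain ⟨p, rfl⟩ := Ideal.Quotient.mk_surjective x
    rw [← sum_taylor_eq p μ, Polynomial.sum, map_sum]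
    refine Submodule.sum_mem _ fun n _ => ?_
    rw [← smul_eq_C_mul]
    change Ideal.Quotient.mkₐ ℝ I _ ∈ _
    rw [map_smul]
    refine Submodule.smul_mem _ _ ?_
    change Ideal.Quotient.mk I _ ∈ _
    by_cases hn : e ≤ n
    · rw [hzero n hn]; exact Submodule.zero_mem _
    · refine Submodule.subset_span ⟨⟨e - 1 - n, by omega⟩, ?_⟩
      simp only [hv]
      congr 2
      omega
  have hcard : Fintype.card (Fin e) = Module.finrank ℝ (ℝ[X] ⧸ I) := by
    rw [hI, finrank_quotient_span_eq_natDegree, natDegree_pow, natDegree_X_sub_C]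
    simp
  refine ⟨basisOfTopLeSpanOfCardEqFinrank v hspan hcard, fun j => ?_⟩
  simp only [coe_basisOfTopLeSpanOfCardEqFinrank]
  have hX : (X : ℝ[X]) • v j =
      μ • v j + Ideal.Quotient.mk I ((X - C μ) ^ (e - 1 - (j : ℕ) + 1)) := by
    rw [← sub_eq_iff_eq_add']
    have h2 : μ • v j = Ideal.Quotient.mk I (C μ * (X - C μ) ^ (e - 1 - (j : ℕ))) := by
      rw [← smul_eq_C_mul]; rfl
    have h1 : (X : ℝ[X]) • v j = Ideal.Quotient.mk I (X * (X - C μ) ^ (e - 1 - (j : ℕ))) := rfl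
    rw [h1, h2, ← map_sub]
    congr 1
    ring
  rw [hX, ← Finset.add_sum_erase _ _ (Finset.mem_univ j)]
  congr 1
  · simp [jordanBlock]
  · rcases Nat.eq_zero_or_pos (j : ℕ) with hj | hj
    · rw [hzero _ (by omega)]
      refine (Finset.sum_eq_zero fun i hi => ?_).symm
      have hij : i ≠ j := Finset.ne_of_mem_erase hi
      simp [jordanBlock, hij, hj]
    · have hlt : (j : ℕ) - 1 < e := by omega
      rw [Finset.sum_eq_single (⟨j - 1, hlt⟩ : Fin e)]
      · have hne : (⟨j - 1, hlt⟩ : Fin e) ≠ j := fun h => by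
          have := congrArg Fin.val h
          simp only at this
          omega
        simp only [jordanBlock, Matrix.of_apply, hne, if_false, Nat.sub_add_cancel hj, if_true,
          one_smul, hv]
        congr 2
        omega
      · intro i hi hne
        have hij : i ≠ j := Finset.ne_of_mem_erase hi
        have : (i : ℕ) + 1 ≠ j := fun h => hne (Fin.ext (by simp only; omega))
        simp [jordanBlock, hij, this]
      · intro h
        refine absurd (Finset.mem_erase.2 ⟨fun h => ?_, Finset.mem_univ _⟩) h
        have := congrArg Fin.val h
        simp only at this
        omega

/-- A Jordan basis gives a Jordan form; empty blocks are dropped. -/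
theorem nonempty_jordanForm_of_basis {k : ℕ} (A : Matrix (Fin k) (Fin k) ℝ) {ι : Type*}
    [Fintype ι] (e : ι → ℕ) (μ : ι → ℝ)
    (b : Module.Basis (Σ i, Fin (e i)) ℝ (Fin k → ℝ))
    (hb : ∀ i j, A.mulVec (b ⟨i, j⟩) = ∑ l, jordanBlock (e i) (μ i) l j • b ⟨i, l⟩) :
    Nonempty (JordanForm A) := by
  classical
  set τ := (Fintype.equivFin {i : ι // e i ≠ 0}).symm
  let φ : (Σ a, Fin (e (τ a))) → Σ i, Fin (e i) := fun x => ⟨τ x.1, x.2⟩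
  have hφ : Function.Bijective φ := by
    constructor
    · rintro ⟨a, i⟩ ⟨a', i'⟩ h
      simp only [φ, Sigma.mk.injEq] at h
      obtain rfl := τ.injective (Subtype.ext h.1)
      simpa using h
    · rintro ⟨i, j⟩
      have hi : e i ≠ 0 := fun h => (Fin.elim0 (h ▸ j))
      obtain ⟨a, ha⟩ := τ.surjective ⟨i, hi⟩
      have ha' : (τ a : ι) = i := congrArg Subtype.val ha
      subst ha'
      exact ⟨⟨a, j⟩, rfl⟩
  let c := b.reindex (Equiv.ofBijective φ hφ).symm
  have hc : ∀ a j, c ⟨a, j⟩ = b ⟨τ a, j⟩ := fun a j => by simp [c, φ]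
  let idx : (Σ a, Fin (e (τ a))) ≃ Fin k :=
    Fintype.equivFinOfCardEq (by
      rw [← Module.finrank_eq_card_basis c, Module.finrank_fin_fun])
  let P := (Pi.basisFun ℝ (Fin k)).toMatrix (c.reindex idx)
  have hP : IsUnit P := by
    have := (Pi.basisFun ℝ (Fin k)).invertibleToMatrix (c.reindex idx)
    exact isUnit_of_invertible P
  have hPdet : IsUnit P.det := (Matrix.isUnit_iff_isUnit_det P).1 hP
  refine ⟨⟨_, fun a => e (τ a), fun a => Nat.one_le_iff_ne_zero.2 (τ a).2, fun a => μ (τ a), idx,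
    P⁻¹, (Matrix.isUnit_nonsing_inv_iff).2 hP, ?_⟩⟩
  rw [Matrix.nonsing_inv_nonsing_inv _ hPdet]
  -- The columns of P are the Jordan basis, so this is the hypothesis on the basis read column by
  -- column.
  have hAP : A * P = P * Matrix.reindex idx idx
      (Matrix.blockDiagonal' fun a => jordanBlock (e (τ a)) (μ (τ a))) := by
    ext r s
    obtain ⟨⟨a, j⟩, rfl⟩ := idx.surjective s
    have h1 := congrFun (hb (τ a) j) r
    rw [Finset.sum_apply] at h1
    simp only [Matrix.mul_apply]
    conv_rhs => rw [← idx.sum_comp, Fintype.sum_sigma]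
    refine Eq.trans ?_ (Finset.sum_eq_single a ?_ ?_).symm
    · simp only [Matrix.reindex_apply, Matrix.submatrix_apply, Equiv.symm_apply_apply,
        Matrix.blockDiagonal'_apply_eq]
      simp only [P, Module.Basis.toMatrix_apply, Pi.basisFun_repr, Module.Basis.reindex_apply,
        Equiv.symm_apply_apply, hc]
      simpa [Matrix.mulVec, dotProduct, mul_comm] using h1
    · intro a' _ hne
      refine Finset.sum_eq_zero fun l _ => ?_
      simp [Matrix.blockDiagonal'_apply_ne _ _ _ hne]
    · simp
  rw [← hAP, Matrix.mul_nonsing_inv_cancel_right _ _ hPdet]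

theorem isUnit_of_isUnit_map_ofReal {k : ℕ} {B : Matrix (Fin k) (Fin k) ℝ}
    (h : IsUnit (B.map (fun x : ℝ => (x : ℂ)))) : IsUnit B := by
  rw [Matrix.isUnit_iff_isUnit_det] at h ⊢
  have : (B.map (fun x : ℝ => (x : ℂ))).det = ((B.det : ℝ) : ℂ) :=
    (RingHom.map_det Complex.ofRealHom B).symm
  rw [this] at h
  exact isUnit_iff_ne_zero.2 fun h0 => by simp [h0] at h

-- Over ℂ, spectral mapping gives an eigenvalue z of A with p(z) = 0, and z is real by hypothesis.
open Polynomial in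
theorem exists_isRoot_of_not_isUnit_aeval {k : ℕ} (hk : 1 ≤ k) {A : Matrix (Fin k) (Fin k) ℝ}
    (hA : spectrum ℂ (A.map (fun x : ℝ => (x : ℂ))) ⊆ Set.range (fun x : ℝ => (x : ℂ)))
    {p : ℝ[X]} (hp : ¬ IsUnit (aeval A p)) : ∃ x, p.IsRoot x := by
  have : Nonempty (Fin k) := ⟨⟨0, hk⟩⟩
  have hmap : aeval (A.map (fun x : ℝ => (x : ℂ))) (p.map Complex.ofRealHom) =
      (aeval A p).map (fun x : ℝ => (x : ℂ)) := by
    have h := aeval_algHom_apply (Complex.ofRealAm.mapMatrix (m := Fin k)) A p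
    rw [show (A.map fun x : ℝ => (x : ℂ)) = Complex.ofRealAm.mapMatrix A from rfl]
    refine Eq.trans ?_ h
    exact aeval_map_algebraMap ℂ _ p
  have h0 : (0 : ℂ) ∈ spectrum ℂ
      (aeval (A.map (fun x : ℝ => (x : ℂ))) (p.map Complex.ofRealHom)) := by
    rw [spectrum.zero_mem_iff, hmap]
    exact fun h => hp (isUnit_of_isUnit_map_ofReal h)
  rw [spectrum.map_polynomial_aeval_of_nonempty _ _
    (spectrum.nonempty_of_isAlgClosed_of_finiteDimensional ℂ _)] at h0
  obtain ⟨z, hz, hz0⟩ := h0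
  obtain ⟨x, rfl⟩ := hA hz
  refine ⟨x, ?_⟩
  have : ((p.eval x : ℝ) : ℂ) = 0 := by
    rw [← hz0]
    exact (eval_map_apply (f := Complex.ofRealHom) (x := x) (p := p)).symm
  exact_mod_cast this

open Polynomial in
/-- A real matrix with only real eigenvalues has a real Jordan form. -/
theorem nonempty_jordanForm {k : ℕ} (hk : 1 ≤ k) (A : Matrix (Fin k) (Fin k) ℝ)
    (hA : spectrum ℂ (A.map (fun x : ℝ => (x : ℂ))) ⊆ Set.range (fun x : ℝ => (x : ℂ))) :
    Nonempty (JordanForm A) := by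
  classical
  let T := Matrix.toLin' A
  -- X acts on ℝ^k as A, and this torsion module splits into summands ℝ[X] / (p i ^ e i) with p i
  -- irreducible.
  obtain ⟨ι, _, p, hp, e, ⟨Φ⟩⟩ := Module.equiv_directSum_of_isTorsion
    (Module.AEval.isTorsion_of_finiteDimensional ℝ (Fin k → ℝ) T)
  let Q : ι → Type := fun i => ℝ[X] ⧸ Submodule.span ℝ[X] {p i ^ e i}
  let Ψ : Module.AEval ℝ (Fin k → ℝ) T ≃ₗ[ℝ[X]] ∀ i, Q i :=
    Φ.trans (DirectSum.linearEquivFunOnFintype ℝ[X] ι Q)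
  have haeval : ∀ q : ℝ[X], ∀ x : ∀ i, Q i, (aeval A q).mulVec
      ((Module.AEval.of ℝ (Fin k → ℝ) T).symm (Ψ.symm x)) =
      (Module.AEval.of ℝ (Fin k → ℝ) T).symm (Ψ.symm (q • x)) := fun q x => by
    rw [map_smul, Module.AEval.of_symm_smul]
    have : aeval T q = Matrix.toLin' (aeval A q) :=
      aeval_algHom_apply (Matrix.toLinAlgEquiv' (R := ℝ) (n := Fin k)).toAlgHom A q
    rw [this]
    rfl
  have hideal : ∀ i, ∃ μ : ℝ, (Submodule.span ℝ[X] {p i ^ e i} : Ideal ℝ[X]) =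
      Ideal.span {(X - C μ) ^ e i} := by
    intro i
    rcases eq_or_ne (e i) 0 with he | he
    · exact ⟨0, by simp [he, Ideal.span]⟩
    -- The class of p i ^ (e i - 1) is nonzero and killed by p i, so p i (A) is singular. Hence p i
    -- has a real root and, being irreducible, is associated to X - μ.
    obtain ⟨μ, hμ⟩ := exists_isRoot_of_not_isUnit_aeval hk hA (p := p i) fun hu => by
      let v : Q i := Submodule.Quotient.mk (p i ^ (e i - 1))
      have hv : v ≠ 0 := fun h => by
        have h := (Submodule.Quotient.mk_eq_zero _).1 h
        have h := Ideal.mem_span_singleton.1 h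
        have := (pow_dvd_pow_iff (hp i).ne_zero (hp i).not_isUnit).1 h
        omega
      have hpv : p i • v = 0 := by
        change Submodule.Quotient.mk (p i * p i ^ (e i - 1)) = 0
        rw [Submodule.Quotient.mk_eq_zero, mul_pow_sub_one he]
        exact Submodule.mem_span_singleton_self _
      have h := haeval (p i) (Pi.single i v)
      rw [← Pi.single_smul, hpv, Pi.single_zero, map_zero, map_zero] at h
      have h' := Matrix.mulVec_injective_of_isUnit hu (h.trans (Matrix.mulVec_zero _).symm)
      simp only [EmbeddingLike.map_eq_zero_iff, Pi.single_eq_zero_iff] at h'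
      exact hv h'
    refine ⟨μ, ?_⟩
    have hassoc : Associated (X - C μ) (p i) :=
      (irreducible_X_sub_C μ).associated_of_dvd (hp i) (dvd_iff_isRoot.2 hμ)
    exact (Ideal.span_singleton_eq_span_singleton.2 (hassoc.pow_pow)).symm
  choose μ hμ using hideal
  choose b hb using fun i => exists_basis_quotient_X_sub_C_pow (μ i) (e i) _ (hμ i)
  let Ψ' : (∀ i, Q i) ≃ₗ[ℝ] (Fin k → ℝ) :=
    (Ψ.symm.restrictScalars ℝ).trans (Module.AEval.of ℝ (Fin k → ℝ) T).symm
  refine nonempty_jordanForm_of_basis A e μ ((Pi.basis b).map Ψ') fun i j => ?_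
  have h := haeval X (Pi.single i (b i j))
  rw [aeval_X, ← Pi.single_smul, hb] at h
  simp only [Module.Basis.map_apply, Pi.basis_apply]
  refine h.trans ?_
  change Ψ' _ = _
  rw [← LinearMap.coe_single (R := ℝ) , map_sum, map_sum]
  simp [map_smul]

/-! ### Polynomials evaluated at a matrix in Jordan form -/

theorem charpoly_jordanBlock (s : ℕ) (μ : ℝ) :
    (jordanBlock s μ).charpoly = (Polynomial.X - Polynomial.C μ) ^ s := by
  rw [Matrix.charpoly_of_isUpperTriangular]
  · simp [jordanBlock]
  · intro i j hij
    have hij' : (j : ℕ) < i := hij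
    have h1 : i ≠ j := fun h => by simp [h] at hij'
    have h2 : (i : ℕ) + 1 ≠ j := by omega
    simp [jordanBlock, h1, h2]

theorem jordanBlock_sub_pow (s : ℕ) (μ : ℝ) :
    (jordanBlock s μ - algebraMap ℝ _ μ) ^ s = 0 := by
  have h := Matrix.aeval_self_charpoly (jordanBlock s μ)
  rw [charpoly_jordanBlock] at h
  simpa using h

-- Taylor's formula at μ: powers r ≥ s of the nilpotent part vanish, and the Hasse derivative
-- absorbs 1 / r!.
open Polynomial in
theorem aeval_jordanBlock (s : ℕ) (μ : ℝ) (p : ℝ[X]) :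
    aeval (jordanBlock s μ) p = ∑ r ∈ Finset.range s,
      (hasseDeriv r p).eval μ • (jordanBlock s μ - algebraMap ℝ _ μ) ^ r := by
  conv_lhs => rw [← sum_taylor_eq p μ]
  rw [Polynomial.sum_over_range' _ (by simp) (max s ((taylor μ p).natDegree + 1)) (by simp),
    map_sum]
  have hsub : Finset.range s ⊆ Finset.range (max s ((taylor μ p).natDegree + 1)) :=
    Finset.range_subset_range.2 (le_max_left _ _)
  rw [← Finset.sum_subset hsub]
  · refine Finset.sum_congr rfl fun r _ => ?_
    simp [taylor_coeff, Algebra.smul_def]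
  · intro r _ hr
    rw [Finset.mem_range, not_lt] at hr
    have : (jordanBlock s μ - algebraMap ℝ _ μ) ^ r = 0 :=
      pow_eq_zero_of_le hr (jordanBlock_sub_pow s μ)
    simp only [map_mul, map_pow, map_sub, aeval_X, aeval_C, this, mul_zero]

namespace JordanForm

variable {k : ℕ} {A : Matrix (Fin k) (Fin k) ℝ} (J : JordanForm A)

/-- Block diagonal matrices in the basis of a Jordan form. -/
noncomputable def blockAlgHom :
    (∀ i, Matrix (Fin (J.size i)) (Fin (J.size i)) ℝ) →ₐ[ℝ] Matrix (Fin k) (Fin k) ℝ :=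
  AlgHom.ofLinearMap
    { toFun := fun M =>
        J.Z⁻¹ * Matrix.reindexAlgEquiv ℝ ℝ J.index (Matrix.blockDiagonal' M) * J.Z
      map_add' := fun M N => by
        rw [Matrix.blockDiagonal'_add, map_add, Matrix.mul_add, Matrix.add_mul]
      map_smul' := fun c M => by
        rw [Matrix.blockDiagonal'_smul, map_smul, Matrix.mul_smul, Matrix.smul_mul]; rfl }
    (by
      have h := (Matrix.isUnit_iff_isUnit_det J.Z).1 J.isUnit_Z
      simp [Matrix.blockDiagonal'_one, Matrix.nonsing_inv_mul _ h])
    (fun M N => by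
      have h := (Matrix.isUnit_iff_isUnit_det J.Z).1 J.isUnit_Z
      change J.Z⁻¹ * Matrix.reindexAlgEquiv ℝ ℝ J.index
          (Matrix.blockDiagonal' fun i => M i * N i) * J.Z = _
      rw [Matrix.blockDiagonal'_mul, map_mul]
      simp only [LinearMap.coe_mk, AddHom.coe_mk, Matrix.mul_assoc,
        Matrix.mul_nonsing_inv_cancel_left _ _ h])

theorem blockAlgHom_apply (M : ∀ i, Matrix (Fin (J.size i)) (Fin (J.size i)) ℝ) :
    J.blockAlgHom M =
      J.Z⁻¹ * Matrix.reindexAlgEquiv ℝ ℝ J.index (Matrix.blockDiagonal' M) * J.Z := rfl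

theorem blockAlgHom_jordanBlock :
    J.blockAlgHom (fun i => jordanBlock (J.size i) (J.eigenvalue i)) = A :=
  J.eq_conj.symm

theorem blockAlgHom_injective : Function.Injective J.blockAlgHom := by
  have h := (Matrix.isUnit_iff_isUnit_det J.Z).1 J.isUnit_Z
  intro M N hMN
  rw [blockAlgHom_apply, blockAlgHom_apply] at hMN
  have h1 := J.isUnit_Z.mul_left_injective hMN
  have h2 := ((Matrix.isUnit_nonsing_inv_iff).2 J.isUnit_Z).mul_right_injective h1
  exact Matrix.blockDiagonal'_injective ((Matrix.reindexAlgEquiv ℝ ℝ J.index).injective h2)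

theorem aeval_eq (p : Polynomial ℝ) :
    Polynomial.aeval A p = J.blockAlgHom fun i =>
      Polynomial.aeval (jordanBlock (J.size i) (J.eigenvalue i)) p := by
  conv_lhs => rw [← J.blockAlgHom_jordanBlock]
  rw [Polynomial.aeval_algHom_apply]
  congr 1
  funext i
  exact (Polynomial.aeval_algHom_apply (Pi.evalAlgHom ℝ
    (fun i => Matrix (Fin (J.size i)) (Fin (J.size i)) ℝ) i) _ p).symm

/-- A power of A - μ_i annihilates the projection onto the i-th block. Were A - μ_i invertible, that
projection would vanish, although the block is nonempty. -/
theorem eigenvalue_mem_spectrum (i : Fin J.numBlocks) :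
    (J.eigenvalue i : ℂ) ∈ spectrum ℂ (A.map (fun x : ℝ => (x : ℂ))) := by
  by_contra hns
  rw [spectrum.notMem_iff] at hns
  have hu : IsUnit (A - algebraMap ℝ _ (J.eigenvalue i)) := by
    rw [← IsUnit.neg_iff, neg_sub]
    refine isUnit_of_isUnit_map_ofReal ?_
    convert! hns using 1
    have h := map_sub (Complex.ofRealAm.mapMatrix (m := Fin k))
      (algebraMap ℝ _ (J.eigenvalue i)) A
    rw [AlgHom.commutes] at h
    exact h
  have hpow : (A - algebraMap ℝ _ (J.eigenvalue i)) ^ J.size i *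
      J.blockAlgHom (Pi.single i 1) = 0 := by
    have hA : A - algebraMap ℝ _ (J.eigenvalue i) = J.blockAlgHom
        ((fun i => jordanBlock (J.size i) (J.eigenvalue i)) -
          algebraMap ℝ _ (J.eigenvalue i)) := by
      rw [map_sub, J.blockAlgHom_jordanBlock, AlgHom.commutes]
    rw [hA, ← map_pow, ← map_mul, ← map_zero J.blockAlgHom]
    congr 1
    funext j
    rcases eq_or_ne j i with rfl | hj
    · have := jordanBlock_sub_pow (J.size j) (J.eigenvalue j)
      simpa using this
    · simp [hj]
  have h0 : J.blockAlgHom (Pi.single i 1) = 0 := (hu.pow (J.size i)).mul_right_eq_zero.1 hpow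
  have h1 := J.blockAlgHom_injective (h0.trans (map_zero J.blockAlgHom).symm)
  have : Nonempty (Fin (J.size i)) := ⟨⟨0, J.size_pos i⟩⟩
  simp at h1

theorem size_le (i : Fin J.numBlocks) : J.size i ≤ k := by
  have h := Fintype.card_congr J.index
  simp only [Fintype.card_sigma, Fintype.card_fin] at h
  refine le_of_le_of_eq ?_ h
  exact Finset.single_le_sum (f := J.size) (fun _ _ => Nat.zero_le _) (Finset.mem_univ i)

theorem size_le_largestJordanBlockSize (i : Fin J.numBlocks) :
    J.size i ≤ largestJordanBlockSize A :=
  -- `sSup` is the true supremum only for a bounded set; k bounds the block sizes of every Jordan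
  -- form.
  le_csSup ⟨k, by rintro _ ⟨J', i', rfl⟩; exact J'.size_le i'⟩ ⟨J, i, rfl⟩

/-- The powers of the nilpotent part of a single Jordan block, in the original basis. -/
noncomputable def nilpotentPart (i : Fin J.numBlocks) (r : ℕ) : Matrix (Fin k) (Fin k) ℝ :=
  J.blockAlgHom (Pi.single i
    ((jordanBlock (J.size i) (J.eigenvalue i) - algebraMap ℝ _ (J.eigenvalue i)) ^ r))

theorem aeval_eq_sum (p : Polynomial ℝ) :
    Polynomial.aeval A p = ∑ i, ∑ r ∈ Finset.range (J.size i),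
      (Polynomial.hasseDeriv r p).eval (J.eigenvalue i) • J.nilpotentPart i r := by
  rw [J.aeval_eq, ← Finset.univ_sum_single (fun i =>
    Polynomial.aeval (jordanBlock (J.size i) (J.eigenvalue i)) p), map_sum]
  refine Finset.sum_congr rfl fun i _ => ?_
  rw [aeval_jordanBlock]
  have h := map_sum (J.blockAlgHom.toLinearMap.comp (LinearMap.single ℝ
      (fun i => Matrix (Fin (J.size i)) (Fin (J.size i)) ℝ) i))
    (fun r => (Polynomial.hasseDeriv r p).eval (J.eigenvalue i) •
      (jordanBlock (J.size i) (J.eigenvalue i) - algebraMap ℝ _ (J.eigenvalue i)) ^ r)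
    (Finset.range (J.size i))
  simp only [map_smul] at h
  exact h

end JordanForm

/-! ### Absolute convergence of the matrix series -/

theorem abs_eval_hasseDeriv_T_le (n r : ℕ) {x : ℝ} (hx : |x| ≤ 1) :
    |(Polynomial.hasseDeriv r (Polynomial.Chebyshev.T ℝ (n : ℤ))).eval x| ≤
      (n : ℝ) ^ (2 * r) := by
  refine le_trans ?_ (abs_iterate_derivative_T_le n r hx)
  rw [← Polynomial.factorial_smul_hasseDeriv, LinearMap.smul_apply, Polynomial.eval_smul,
    nsmul_eq_mul, abs_mul, Nat.abs_cast]
  exact le_mul_of_one_le_left (abs_nonneg _) (by exact_mod_cast r.factorial_pos)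

theorem summable_seminorm_matrixChebyshevTerm {k : ℕ} {A : Matrix (Fin k) (Fin k) ℝ}
    (J : JordanForm A) (hJ : ∀ i, |J.eigenvalue i| ≤ 1) {p : ℕ} (hp : ∀ i, 2 * J.size i ≤ p + 2)
    {f : ℝ → ℝ} {C : ℝ} (hC : ∀ n : ℕ, |chebyshevCoeff f n| ≤ C / (n + 1) ^ (p + 2))
    (ν : Seminorm ℝ (Matrix (Fin k) (Fin k) ℝ)) :
    Summable fun n : ℕ => ν (matrixChebyshevTerm f A n) := by
  have hC0 : 0 ≤ C := by simpa using (abs_nonneg _).trans (hC 0)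
  set K : ℝ := ∑ i, ∑ r ∈ Finset.range (J.size i), ν (J.nilpotentPart i r)
  have hsum : Summable fun n : ℕ => C * K * (1 / ((n : ℝ) + 1) ^ 2) := by
    have h := (summable_nat_add_iff 1).2 (Real.summable_one_div_nat_pow.2 one_lt_two)
    simpa using h.mul_left (C * K)
  refine Summable.of_nonneg_of_le (fun n => apply_nonneg ν _) (fun n => ?_) hsum
  have hT : ν (Polynomial.aeval A (Polynomial.Chebyshev.T ℝ (n : ℤ))) ≤
      ((n : ℝ) + 1) ^ p * K := by
    rw [J.aeval_eq_sum, Finset.mul_sum]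
    refine (Finset.le_sum_of_subadditive ν (map_zero ν).le (map_add_le_add ν) _ _).trans
      (Finset.sum_le_sum fun i _ => ?_)
    rw [Finset.mul_sum]
    refine (Finset.le_sum_of_subadditive ν (map_zero ν).le (map_add_le_add ν) _ _).trans
      (Finset.sum_le_sum fun r hr => ?_)
    rw [map_smul_eq_mul, Real.norm_eq_abs]
    gcongr
    calc _ ≤ (n : ℝ) ^ (2 * r) := abs_eval_hasseDeriv_T_le n r (hJ i)
      _ ≤ ((n : ℝ) + 1) ^ (2 * r) := by gcongr; linarith
      _ ≤ _ := by
        have := hp i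
        have := Finset.mem_range.1 hr
        -- The exponents compare because r ≤ size - 1 gives 2 r ≤ p.
        exact pow_le_pow_right₀ (by linarith [Nat.cast_nonneg (α := ℝ) n]) (by omega)
  have hα : ‖(if n = 0 then 1 / 2 else 1) * chebyshevCoeff f n‖ ≤ C / ((n : ℝ) + 1) ^ (p + 2) := by
    refine le_trans ?_ (hC n)
    rw [norm_mul, Real.norm_eq_abs, Real.norm_eq_abs]
    refine mul_le_of_le_one_left (abs_nonneg _) ?_
    split_ifs <;> norm_num
  rw [matrixChebyshevTerm, map_smul_eq_mul]
  calc _ ≤ C / ((n : ℝ) + 1) ^ (p + 2) * (((n : ℝ) + 1) ^ p * K) :=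
        mul_le_mul hα hT (apply_nonneg ν _) (by positivity)
    _ = C * K * (1 / ((n : ℝ) + 1) ^ 2) := by field_simp; ring

theorem mainTheorem1 (k : ℕ) (hk : 1 ≤ k) (A : Matrix (Fin k) (Fin k) ℝ)
    (hA : spectrum ℂ (A.map (fun x : ℝ => (x : ℂ))) ⊆ (fun x : ℝ => (x : ℂ)) '' Icc (-1) 1)
    (m : ℕ) (hm : m = largestJordanBlockSize A)
    (f : ℝ → ℝ)
    (hf : ContDiffOn ℝ ((2 * m - 2 : ℕ) : WithTop ℕ∞) f (Icc (-1) 1))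
    (hac : AbsolutelyContinuousOnInterval
      (iteratedDerivWithin (2 * m - 2) f (Icc (-1) 1)) (-1) 1)
    (hbv : HasDerivOfBoundedVariation
      (iteratedDerivWithin (2 * m - 2) f (Icc (-1) 1)) (-1) 1) :
    (∀ ν : Seminorm ℝ (Matrix (Fin k) (Fin k) ℝ),
      Summable fun n : ℕ => ν (matrixChebyshevTerm f A n)) ∧
    ∃ S : Matrix (Fin k) (Fin k) ℝ,
      Tendsto (fun N : ℕ => matrixChebyshevPartialSum f A N) atTop (𝓝 S) := by
  obtain ⟨J⟩ := nonempty_jordanForm hk A (hA.trans (image_subset_range _ _))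
  have hJ : ∀ i, |J.eigenvalue i| ≤ 1 := fun i => by
    obtain ⟨x, hx, hxe⟩ := hA (J.eigenvalue_mem_spectrum i)
    rw [← Complex.ofReal_injective hxe]
    exact abs_le.2 hx
  obtain ⟨C, hC⟩ := exists_abs_chebyshevCoeff_le hf hac hbv
  have hp : ∀ i, 2 * J.size i ≤ 2 * m - 2 + 2 := fun i => by
    have := J.size_le_largestJordanBlockSize i
    omega
  have hsum := summable_seminorm_matrixChebyshevTerm J hJ hp hC
  refine ⟨hsum, ?_⟩
  -- The absolute value of a matrix entry is itself a seminorm, so the series converges entrywise.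
  have hS : Summable fun n : ℕ => matrixChebyshevTerm f A n := by
    refine Pi.summable.2 fun i => Pi.summable.2 fun j => Summable.of_norm ?_
    exact hsum ((normSeminorm ℝ ℝ).comp (Matrix.entryLinearMap ℝ ℝ i j))
  exact ⟨_, hS.hasSum.tendsto_sum_nat.comp (tendsto_add_atTop_nat 1)⟩
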